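/- Let $(M,\phi,\xi,\eta,g)$ be a $(2n+1)$-dimensional Kenmotsu manifold, that is, a smooth manifold $M$ of dimension $2n+1$ with a Riemannian metric $g$, a $(1,1)$-tensor field $\phi$, a vector field $\xi$ and a $1$-form $\eta$ (all smooth) such that $$\phi^2=-I+\eta\otimes\xi,\quad \eta(\xi)=1,\quad \eta=g(\xi,\cdot),\quad g(\phi\,\cdot,\phi\,\cdot)=g-\eta\otimes\eta,$$ and whose Levi-Civita connection $\nabla$ satisfies $(\nabla_X\phi)Y=g(\phi X,Y)\xi-\eta(Y)\phi X$ for all vector fields $X,Y$ on $M$. Let $a>0$ be a constant and let $\overline g=ag+a(a-1)\,\eta\otimes\eta$ be the metric of the $D$-homothetically deformed structure $(\overline\phi,\overline\xi,\overline\eta,\overline g)=(\phi,\tfrac1a\xi,a\eta,\overline g)$. Denote by $\overline\nabla$ and $\overline{\mathrm{Ric}}$ the Levi-Civita connection and the Ricci tensor of $\overline g$, by $\overline{\mathrm{grad}}(f)$ the $\overline g$-gradient of a function $f$, by $\overline{\mathrm{Hess}}(f)(X,Y)=\overline g(\overline\nabla_X\overline{\mathrm{grad}}(f),Y)$ its Hessian,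 by $\overline\Delta(f)$ the trace of $X\mapsto\overline\nabla_X\overline{\mathrm{grad}}(f)$, and by $|T|^2_{\overline g}=\sum_{i,j}T(e_i,e_j)^2$ (for a $\overline g$-orthonormal frame $(e_i)$) the squared Hilbert--Schmidt norm of a $(0,2)$-tensor field $T$. Let $f$ and $\overline\lambda$ be smooth functions on $M$ such that, with $V=\overline{\mathrm{grad}}(f)$, the pair $(V,\overline\lambda)$ defines a gradient almost Ricci soliton on $(M,\overline g)$, i.e. $$\tfrac12\pounds_V\overline g+\overline{\mathrm{Ric}}=\overline\lambda\,\overline g,$$ where $\pounds_V$ is the Lie derivative. Then, at every point of $M$, $$|\overline{\mathrm{Ric}}|^2_{\overline g}\ \ge\ |\overline{\mathrm{Hess}}(f)|^2_{\overline g}-\frac{1}{2n+1}\bigl(\overline\Delta(f)\bigr)^2 .$$ -/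

import Mathlib

open scoped Manifold ContDiff

noncomputable section

open Bundle FiberBundle NormedSpace Module VectorField
open scoped Topology

set_option linter.unusedSectionVars false

variable {E : Type*} [NormedAddCommGroup E] [NormedSpace ℝ E] [FiniteDimensional ℝ E]
  {H : Type*} [TopologicalSpace H] {I : ModelWithCorners ℝ E H}
  {M : Type*} [TopologicalSpace M] [ChartedSpace H M] [IsManifold I ∞ M]

namespace Riem

instance (x : M) : FiniteDimensional ℝ (TangentSpace I x) :=
  inferInstanceAs (FiniteDimensional ℝ E)
instance (x : M) : T2Space (TangentSpace I x) :=
  inferInstanceAs (T2Space E)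

-- `g` is a smooth Riemannian metric on `M`.
variable (g : ContMDiffRiemannianMetric I ∞ E (fun x : M ↦ TangentSpace I x))

theorem inner_injective (x : M) : Function.Injective (g.inner x).toLinearMap := by
  rw [injective_iff_map_eq_zero]
  intro v hv
  by_contra h
  have h1 := g.pos x v h
  have h2 : g.inner x v = 0 := hv
  rw [h2] at h1
  simp at h1

/-- The musical isomorphism `v ↦ g(v, ·)` from tangent vectors to covectors at `x`. -/
def flat (x : M) : TangentSpace I x ≃ₗ[ℝ] (TangentSpace I x →L[ℝ] ℝ) :=
  ((g.inner x).toLinearMap).linearEquivOfInjective (inner_injective g x) <| by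
    rw [← (LinearMap.toContinuousLinearMap (𝕜 := ℝ) (E := TangentSpace I x) (F' := ℝ)).finrank_eq]
    exact (Subspace.dual_finrank_eq (K := ℝ) (V := TangentSpace I x)).symm

theorem flat_apply (x : M) (v w : TangentSpace I x) : flat g x v w = g.inner x v w := rfl

theorem inner_flat_symm (x : M) (α : TangentSpace I x →L[ℝ] ℝ) (w : TangentSpace I x) :
    g.inner x ((flat g x).symm α) w = α w := by
  rw [← flat_apply, LinearEquiv.apply_symm_apply]

variable {g} in
theorem mdifferentiableAt_inner {X Y : Π x : M, TangentSpace I x} {x : M}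
    (hX : MDiffAt (T% X) x) (hY : MDiffAt (T% Y) x) :
    MDiffAt (fun y ↦ g.inner y (X y) (Y y)) x := by
  let : RiemannianBundle (fun x : M ↦ TangentSpace I x) := ⟨g.toRiemannianMetric⟩
  exact MDifferentiableAt.inner_bundle (IB := I) (F := E) (E := fun x : M ↦ TangentSpace I x) hX hY

/-- The right-hand side of the Koszul formula. -/
def koszul (Y X Z : Π x : M, TangentSpace I x) (x : M) : ℝ :=
  d% (fun y ↦ g.inner y (Y y) (Z y)) x (X x) + d% (fun y ↦ g.inner y (X y) (Z y)) x (Y x)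
    - d% (fun y ↦ g.inner y (X y) (Y y)) x (Z x)
    + g.inner x (mlieBracket I X Y x) (Z x) - g.inner x (mlieBracket I X Z x) (Y x)
    - g.inner x (mlieBracket I Y Z x) (X x)

theorem tensorial_koszul₁ {Y Z : Π x : M, TangentSpace I x} {x : M}
    (hY : MDiffAt (T% Y) x) (hZ : MDiffAt (T% Z) x) :
    TensorialAt I E (koszul g Y · Z x) x where
  smul {f X} hf hX := by
    have e1 := mvfderiv_fun_mul hf (mdifferentiableAt_inner (g := g) hX hZ)
    have e2 := mvfderiv_fun_mul hf (mdifferentiableAt_inner (g := g) hX hY)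
    simp only [koszul, mlieBracket_smul_left hf hX, Pi.smul_apply', map_smul, map_add,
      _root_.smul_apply, _root_.add_apply, smul_eq_mul, e1, e2]
    rw [g.symm x (X x) (Z x), g.symm x (X x) (Y x)]
    simp
    ring
  add {X X'} hX hX' := by
    have e1 := mvfderiv_fun_add (mdifferentiableAt_inner (g := g) hX hZ)
      (mdifferentiableAt_inner (g := g) hX' hZ)
    have e2 := mvfderiv_fun_add (mdifferentiableAt_inner (g := g) hX hY)
      (mdifferentiableAt_inner (g := g) hX' hY)
    simp only [koszul, mlieBracket_add_left hX hX', Pi.add_apply, map_add,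
      _root_.add_apply, e1, e2]
    ring

theorem tensorial_koszul₂ {X Y : Π x : M, TangentSpace I x} {x : M}
    (hX : MDiffAt (T% X) x) (hY : MDiffAt (T% Y) x) :
    TensorialAt I E (koszul g Y X · x) x where
  smul {f Z} hf hZ := by
    have e1 := mvfderiv_fun_mul hf (mdifferentiableAt_inner (g := g) hY hZ)
    have e2 := mvfderiv_fun_mul hf (mdifferentiableAt_inner (g := g) hX hZ)
    simp only [koszul, mlieBracket_smul_right hf hZ, Pi.smul_apply', map_smul, map_add,
      _root_.smul_apply, _root_.add_apply, smul_eq_mul, e1, e2]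
    rw [g.symm x (Z x) (X x), g.symm x (Z x) (Y x)]
    ring
  add {Z Z'} hZ hZ' := by
    have e1 := mvfderiv_fun_add (mdifferentiableAt_inner (g := g) hY hZ)
      (mdifferentiableAt_inner (g := g) hY hZ')
    have e2 := mvfderiv_fun_add (mdifferentiableAt_inner (g := g) hX hZ)
      (mdifferentiableAt_inner (g := g) hX hZ')
    simp only [koszul, mlieBracket_add_right hZ hZ', Pi.add_apply, map_add,
      _root_.add_apply, e1, e2]
    ring

/-- The Koszul expression of a vector field `Y` differentiable at `x`, as a bilinear form in the
values at `x` of the two other vector fields. -/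
def koszulForm (Y : Π x : M, TangentSpace I x) (x : M) (hY : MDiffAt (T% Y) x) :
    TangentSpace I x →L[ℝ] TangentSpace I x →L[ℝ] ℝ :=
  TensorialAt.mkHom₂ (fun X Z ↦ koszul g Y X Z x) x
    (fun _ hZ ↦ tensorial_koszul₁ g hY hZ) (fun _ hX ↦ tensorial_koszul₂ g hX hY)

theorem koszulForm_apply {X Y Z : Π x : M, TangentSpace I x} {x : M} (hX : MDiffAt (T% X) x)
    (hY : MDiffAt (T% Y) x) (hZ : MDiffAt (T% Z) x) :
    koszulForm g Y x hY (X x) (Z x) = koszul g Y X Z x :=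
  TensorialAt.mkHom₂_apply _ _ hX hZ

open scoped Classical in
/-- `∇_v Y` at `x`, as a linear function of `v`: the vector determined by the Koszul formula
`2 g(∇_X Y, Z) = X g(Y, Z) + Y g(X, Z) - Z g(X, Y) + g([X, Y], Z) - g([X, Z], Y) - g([Y, Z], X)`
(and `0` by convention where `Y` is not differentiable). -/
def leviCivitaFun (Y : Π x : M, TangentSpace I x) (x : M) :
    TangentSpace I x →L[ℝ] TangentSpace I x :=
  if hY : MDiffAt (T% Y) x then
    LinearMap.toContinuousLinearMap
      ((1 / 2 : ℝ) • ((flat g x).symm.toLinearMap ∘ₗ (koszulForm g Y x hY).toLinearMap))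
  else 0

theorem two_mul_inner_leviCivitaFun {X Y Z : Π x : M, TangentSpace I x} {x : M}
    (hX : MDiffAt (T% X) x) (hY : MDiffAt (T% Y) x) (hZ : MDiffAt (T% Z) x) :
    2 * g.inner x (leviCivitaFun g Y x (X x)) (Z x) = koszul g Y X Z x := by
  rw [← koszulForm_apply g hX hY hZ, ← inner_flat_symm g x (koszulForm g Y x hY (X x))]
  simp [leviCivitaFun, hY]

theorem leviCivitaFun_unique {Y : Π x : M, TangentSpace I x} {x : M} (hY : MDiffAt (T% Y) x)
    {A : TangentSpace I x →L[ℝ] TangentSpace I x}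
    (h : ∀ v w : TangentSpace I x,
      2 * g.inner x (A v) w = koszul g Y (extend E v) (extend E w) x) :
    leviCivitaFun g Y x = A := by
  ext v
  apply inner_injective g x
  ext w
  have h1 := two_mul_inner_leviCivitaFun g (mdifferentiableAt_extend I E v) hY
    (mdifferentiableAt_extend I E w)
  rw [← h v w] at h1
  simp only [extend_apply_self] at h1
  simpa using h1

/-- The Levi-Civita connection of `g`, with `∇_X Y` at `x` written `leviCivita g Y x (X x)`. -/
def leviCivita : CovariantDerivative I E (fun x : M ↦ TangentSpace I x) where
  toFun := leviCivitaFun g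
  isCovariantDerivativeOnUniv :=
    { add := by
        intro Y Y' x hY hY' _
        have hs : MDiffAt (T% (Y + Y')) x := mdifferentiableAt_add_section hY hY'
        refine leviCivitaFun_unique g hs fun v w ↦ ?_
        have hv := mdifferentiableAt_extend I E v
        have hw := mdifferentiableAt_extend I E w
        have h1 := two_mul_inner_leviCivitaFun g hv hY hw
        have h2 := two_mul_inner_leviCivitaFun g hv hY' hw
        have e1 := mvfderiv_fun_add (mdifferentiableAt_inner (g := g) hY hw)
          (mdifferentiableAt_inner (g := g) hY' hw)
        have e2 := mvfderiv_fun_add (mdifferentiableAt_inner (g := g) hv hY)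
          (mdifferentiableAt_inner (g := g) hv hY')
        simp only [extend_apply_self] at h1 h2
        simp only [koszul, mlieBracket_add_left hY hY', mlieBracket_add_right hY hY',
          Pi.add_apply, map_add, _root_.add_apply, e1, e2, extend_apply_self, mul_add, h1, h2]
        ring
      leibniz := by
        intro Y f x hY hf _
        have hs : MDiffAt (T% (f • Y)) x := hf.smul_section hY
        refine leviCivitaFun_unique g hs fun v w ↦ ?_
        have hv := mdifferentiableAt_extend I E v
        have hw := mdifferentiableAt_extend I E w
        have h1 := two_mul_inner_leviCivitaFun g hv hY hw
        have e1 := mvfderiv_fun_mul hf (mdifferentiableAt_inner (g := g) hY hw)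
        have e2 := mvfderiv_fun_mul hf (mdifferentiableAt_inner (g := g) hv hY)
        simp only [extend_apply_self] at h1
        simp only [koszul, mlieBracket_smul_left hf hY, mlieBracket_smul_right hf hY,
          Pi.smul_apply', map_smul, map_add, _root_.smul_apply, _root_.add_apply, smul_eq_mul,
          e1, e2, extend_apply_self, mul_add, ContinuousLinearMap.smulRight_apply,
          mul_left_comm (2 : ℝ) (f x), h1]
        rw [g.symm x (Y x) v]
        simp
        ring }

theorem two_mul_inner_leviCivita {X Y Z : Π x : M, TangentSpace I x} {x : M}
    (hX : MDiffAt (T% X) x) (hY : MDiffAt (T% Y) x) (hZ : MDiffAt (T% Z) x) :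
    2 * g.inner x (leviCivita g Y x (X x)) (Z x) = koszul g Y X Z x :=
  two_mul_inner_leviCivitaFun g hX hY hZ

theorem leviCivita_torsion : (leviCivita g).torsion = 0 := by
  rw [CovariantDerivative.torsion_eq_zero_iff]
  intro X Y x hX hY
  apply inner_injective g x
  ext w
  have hw := mdifferentiableAt_extend I E w
  have h1 := two_mul_inner_leviCivita g hX hY hw
  have h2 := two_mul_inner_leviCivita g hY hX hw
  have h3 : mlieBracket I Y X x = - mlieBracket I X Y x := mlieBracket_swap_apply
  have h4 : (fun y ↦ g.inner y (Y y) (X y)) = fun y ↦ g.inner y (X y) (Y y) := by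
    ext y; exact g.symm y _ _
  simp only [koszul, h3, h4, extend_apply_self, map_neg, _root_.neg_apply] at h1 h2
  simp
  linarith

theorem leviCivita_metric {X Y Z : Π x : M, TangentSpace I x} {x : M} (hX : MDiffAt (T% X) x)
    (hY : MDiffAt (T% Y) x) (hZ : MDiffAt (T% Z) x) :
    d% (fun y ↦ g.inner y (Y y) (Z y)) x (X x) =
      g.inner x (leviCivita g Y x (X x)) (Z x) + g.inner x (Y x) (leviCivita g Z x (X x)) := by
  have h1 := two_mul_inner_leviCivita g hX hY hZ
  have h2 := two_mul_inner_leviCivita g hX hZ hY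
  have h3 : mlieBracket I Z Y x = - mlieBracket I Y Z x := mlieBracket_swap_apply
  have h4 : (fun y ↦ g.inner y (Z y) (Y y)) = fun y ↦ g.inner y (Y y) (Z y) := by
    ext y; exact g.symm y _ _
  rw [g.symm x (Y x)]
  simp only [koszul, h3, h4, map_neg, _root_.neg_apply] at h1 h2
  linarith

/-- The curvature `R(X, Y)Z = ∇_X ∇_Y Z - ∇_Y ∇_X Z - ∇_[X, Y] Z` of `g`. -/
def curvature (X Y Z : Π x : M, TangentSpace I x) (x : M) : TangentSpace I x :=
  leviCivita g (fun y ↦ leviCivita g Z y (Y y)) x (X x)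
    - leviCivita g (fun y ↦ leviCivita g Z y (X y)) x (Y x)
    - leviCivita g Z x (mlieBracket I X Y x)

/-- A basis of the tangent space at `x` which is orthonormal for `g`. -/
def orthonormalFrame (x : M) : Basis (Fin (finrank ℝ (TangentSpace I x))) ℝ (TangentSpace I x) :=
  letI : RiemannianBundle (fun x : M ↦ TangentSpace I x) := ⟨g.toRiemannianMetric⟩
  (stdOrthonormalBasis ℝ (TangentSpace I x)).toBasis

theorem inner_orthonormalFrame (x : M) (i j : Fin (finrank ℝ (TangentSpace I x))) :
    g.inner x (orthonormalFrame g x i) (orthonormalFrame g x j) = if i = j then 1 else 0 := by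
  let : RiemannianBundle (fun x : M ↦ TangentSpace I x) := ⟨g.toRiemannianMetric⟩
  have h := (orthonormal_iff_ite (𝕜 := ℝ)).1 (stdOrthonormalBasis ℝ (TangentSpace I x)).orthonormal
    i j
  simp only [orthonormalFrame, OrthonormalBasis.coe_toBasis]
  exact h

/-- The Ricci tensor `Ric(v, w) = tr (u ↦ R(u, v)w) = ∑ i, g(R(e_i, v)w, e_i)` at `x`. The curvature
being tensorial, it is computed with any smooth local extensions of the tangent vectors. -/
def ricci (x : M) (v w : TangentSpace I x) : ℝ :=
  ∑ i, g.inner x (curvature g (extend E (orthonormalFrame g x i)) (extend E v) (extend E w) x)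
    (orthonormalFrame g x i)

/-- The gradient of `f`: `g(grad f, ·) = df`. -/
def gradient (f : M → ℝ) (x : M) : TangentSpace I x := (flat g x).symm (d% f x)

/-- The Hessian `Hess f (v, w) = g(∇_v grad f, w)` at `x`. -/
def hessian (f : M → ℝ) (x : M) (v w : TangentSpace I x) : ℝ :=
  g.inner x (leviCivita g (gradient g f) x v) w

/-- The divergence `div V = tr (v ↦ ∇_v V)`. -/
def divergence (V : Π x : M, TangentSpace I x) (x : M) : ℝ :=
  LinearMap.trace ℝ (TangentSpace I x) (leviCivita g V x).toLinearMap

/-- The Laplace operator `Δ f = div (grad f)`. -/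
def laplacian (f : M → ℝ) (x : M) : ℝ := divergence g (gradient g f) x

/-- The Lie derivative of the metric,
`(L_V g)(X, Y) = V g(X, Y) - g([V, X], Y) - g(X, [V, Y])`, at the tangent vectors `v`, `w` at `x`
(computed with local extensions of `v` and `w`, as it is tensorial in `X` and `Y`). -/
def lieDerivMetric (V : Π x : M, TangentSpace I x) (x : M) (v w : TangentSpace I x) : ℝ :=
  d% (fun y ↦ g.inner y (extend E v y) (extend E w y)) x (V x)
    - g.inner x (mlieBracket I V (extend E v) x) w
    - g.inner x v (mlieBracket I V (extend E w) x)

/-- The squared Hilbert-Schmidt norm `|T|² = ∑ i j, T(e_i, e_j)²` with respect to `g`, at `x`, of a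
`(0, 2)`-tensor `T`. -/
def hsNormSq (x : M) (T : TangentSpace I x → TangentSpace I x → ℝ) : ℝ :=
  ∑ i, ∑ j, T (orthonormalFrame g x i) (orthonormalFrame g x j) ^ 2

/-- `(V, lam)` is an almost Ricci soliton on `(M, g)`: `V` is a smooth vector field, `lam` is a
smooth function, and `(1/2) L_V g + Ric = lam g`. -/
structure IsAlmostRicciSoliton (V : Π x : M, TangentSpace I x) (lam : M → ℝ) : Prop where
  contMDiff_field : ContMDiff I I.tangent ∞ (fun x ↦ (⟨x, V x⟩ : TangentBundle I M))
  contMDiff_lam : ContMDiff I 𝓘(ℝ, ℝ) ∞ lam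
  eqn : ∀ (x : M) (v w : TangentSpace I x),
    (1 / 2 : ℝ) * lieDerivMetric g V x v w + ricci g x v w = lam x * g.inner x v w

end Riem

open Riem

variable (I M) in
/-- An almost contact metric structure `(φ, ξ, η, g)` on `M`. -/
structure AlmostContactMetricStructure where
  g : ContMDiffRiemannianMetric I ∞ E (fun x : M ↦ TangentSpace I x)
  φ : Π x : M, TangentSpace I x →L[ℝ] TangentSpace I x
  ξ : Π x : M, TangentSpace I x
  η : Π x : M, TangentSpace I x →L[ℝ] ℝ
  contMDiff_φ : ContMDiff I (I.prod 𝓘(ℝ, E →L[ℝ] E)) ∞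
    (fun x ↦ TotalSpace.mk' (E →L[ℝ] E) (E := fun x : M ↦ TangentSpace I x →L[ℝ] TangentSpace I x)
      x (φ x))
  contMDiff_ξ : ContMDiff I I.tangent ∞ (fun x ↦ (⟨x, ξ x⟩ : TangentBundle I M))
  contMDiff_η : ContMDiff I (I.prod 𝓘(ℝ, E →L[ℝ] ℝ)) ∞
    (fun x ↦ TotalSpace.mk' (E →L[ℝ] ℝ) (E := fun x : M ↦ TangentSpace I x →L[ℝ] ℝ) x (η x))
  φ_φ : ∀ (x : M) (v : TangentSpace I x), φ x (φ x v) = - v + η x v • ξ x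
  η_ξ : ∀ x : M, η x (ξ x) = 1
  η_eq : ∀ (x : M) (v : TangentSpace I x), η x v = g.inner x (ξ x) v
  inner_φ_φ : ∀ (x : M) (v w : TangentSpace I x),
    g.inner x (φ x v) (φ x w) = g.inner x v w - η x v * η x w

namespace AlmostContactMetricStructure

variable (S : AlmostContactMetricStructure I M)

/-- `(M, φ, ξ, η, g)` is a Kenmotsu manifold: `(∇_X φ)Y = g(φX, Y)ξ - η(Y)φX` for all smooth vector
fields `X`, `Y`, where `(∇_X φ)Y = ∇_X (φY) - φ(∇_X Y)`. -/
def IsKenmotsu : Prop :=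
  ∀ X Y : Π x : M, TangentSpace I x,
    ContMDiff I I.tangent ∞ (fun x ↦ (⟨x, X x⟩ : TangentBundle I M)) →
    ContMDiff I I.tangent ∞ (fun x ↦ (⟨x, Y x⟩ : TangentBundle I M)) →
    ∀ x : M, leviCivita S.g (fun y ↦ S.φ y (Y y)) x (X x) - S.φ x (leviCivita S.g Y x (X x)) =
      S.g.inner x (S.φ x (X x)) (Y x) • S.ξ x - S.η x (Y x) • S.φ x (X x)

theorem φ_ξ (x : M) : S.φ x (S.ξ x) = 0 := by
  by_contra h
  have h1 := S.g.pos x _ h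
  rw [S.inner_φ_φ, ← S.η_eq, S.η_ξ] at h1
  norm_num at h1

theorem η_φ (x : M) (v : TangentSpace I x) : S.η x (S.φ x v) = 0 := by
  have h1 := S.φ_φ x (S.φ x v)
  rw [S.φ_φ x v, map_add, map_neg, map_smul, S.φ_ξ, smul_zero] at h1
  have h2 := congrArg (S.η x) (add_left_cancel h1)
  rw [map_smul, S.η_ξ] at h2
  simpa using h2.symm

theorem contMDiff_deform (a : ℝ) :
    ContMDiff I (I.prod 𝓘(ℝ, E →L[ℝ] E →L[ℝ] ℝ)) ∞
      (fun x ↦ TotalSpace.mk' (E →L[ℝ] E →L[ℝ] ℝ)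
        (E := fun x : M ↦ TangentSpace I x →L[ℝ] TangentSpace I x →L[ℝ] ℝ)
        x (a • S.g.inner x + (a * (a - 1)) • (S.η x).smulRight (S.η x))) := by
  have h : ContMDiff I (I.prod 𝓘(ℝ, E →L[ℝ] E →L[ℝ] ℝ)) ∞
      (fun x ↦ TotalSpace.mk' (E →L[ℝ] E →L[ℝ] ℝ)
        (E := fun x : M ↦ TangentSpace I x →L[ℝ] TangentSpace I x →L[ℝ] ℝ)
        x ((S.η x).smulRight (S.η x))) := by
    intro x
    have hη := S.contMDiff_η x
    rw [contMDiffAt_hom_bundle] at hη ⊢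
    refine ⟨contMDiffAt_id, ?_⟩
    have hc : ContDiff ℝ ∞ (fun c : E →L[ℝ] ℝ ↦ c.smulRight c) :=
      contDiff_id.smulRight contDiff_id
    have h2 := hc.contMDiff.contMDiffAt.comp x hη.2
    refine h2.congr_of_eventuallyEq ?_
    have hb : ∀ᶠ y in 𝓝 x, y ∈ (trivializationAt E (fun x : M ↦ TangentSpace I x) x).baseSet :=
      (trivializationAt E (fun x : M ↦ TangentSpace I x) x).open_baseSet.mem_nhds
        (mem_baseSet_trivializationAt' x)
    filter_upwards [hb] with y hy
    ext v w
    have e := inCoordinates_apply_eq₂ (𝕜 := ℝ) (F₁ := E) (F₂ := E) (F₃ := ℝ)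
      (E₁ := fun x : M ↦ TangentSpace I x) (E₂ := fun x : M ↦ TangentSpace I x)
      (E₃ := Bundle.Trivial M ℝ) (x₀ := x) (x := y) (ϕ := (S.η y).smulRight (S.η y))
      (v := v) (w := w) hy hy (Set.mem_univ _)
    refine e.trans ?_
    simp [ContinuousLinearMap.inCoordinates]
    rw [Bundle.Trivialization.symmL_apply, Bundle.Trivialization.symmL_apply]
    all_goals exact hy
  exact (S.g.contMDiff.const_smul_section (a := a)).add_section
    (h.const_smul_section (a := a * (a - 1)))

theorem le_deform (a : ℝ) (ha : 0 < a) (x : M) (v : TangentSpace I x) :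
    a * a * S.g.inner x v v ≤
      (1 + a) * (a * S.g.inner x v v + a * (a - 1) * (S.η x v * S.η x v)) := by
  have h2 := S.inner_φ_φ x v v
  have h3 : 0 ≤ S.g.inner x (S.φ x v) (S.φ x v) := by
    by_cases h : S.φ x v = 0
    · simp [h]
    · exact (S.g.pos x _ h).le
  have h4 : S.g.inner x v v = S.g.inner x (S.φ x v) (S.φ x v) + S.η x v * S.η x v := by linarith
  rw [h4]
  have h5 := mul_nonneg ha.le h3
  have h6 := mul_nonneg (pow_pos ha 3).le (mul_self_nonneg (S.η x v))
  nlinarith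

/-- The metric `a g + a (a - 1) η ⊗ η` of the `D`-homothetic deformation. -/
def deformMetric (a : ℝ) (ha : 0 < a) :
    ContMDiffRiemannianMetric I ∞ E (fun x : M ↦ TangentSpace I x) where
  inner x := a • S.g.inner x + (a * (a - 1)) • (S.η x).smulRight (S.η x)
  symm x v w := by
    have h := S.g.symm x v w
    simp only [_root_.add_apply, _root_.smul_apply, ContinuousLinearMap.smulRight_apply,
      smul_eq_mul, h]
    ring
  pos x v hv := by
    have h1 := S.g.pos x v hv
    have h3 := mul_le_mul_of_nonneg_left (S.le_deform a ha x v) (mul_pos ha ha).le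
    by_contra h
    push Not at h
    have h4 : (1 + a) * (a * S.g.inner x v v + a * (a - 1) * (S.η x v * S.η x v)) ≤ 0 :=
      mul_nonpos_of_nonneg_of_nonpos (by linarith) (by simpa using h)
    have h5 : 0 < a * a * S.g.inner x v v := mul_pos (mul_pos ha ha) h1
    have h6 := S.le_deform a ha x v
    linarith
  isVonNBounded x := by
    have hc : 0 < (1 + a) / a := by positivity
    refine ((S.g.isVonNBounded x).image
      (((1 + a) / a) • ContinuousLinearMap.id ℝ (TangentSpace I x))).subset ?_
    intro v hv
    refine ⟨((1 + a) / a)⁻¹ • v, ?_, ?_⟩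
    swap
    · change ((1 + a) / a) • (((1 + a) / a)⁻¹ • v) = v
      rw [smul_smul, mul_inv_cancel₀ hc.ne', one_smul]
    have h1 := S.le_deform a ha x v
    have h2 : a * S.g.inner x v v + a * (a - 1) * (S.η x v * S.η x v) < 1 := by simpa using hv
    have h3 : a * a * S.g.inner x v v < (1 + a) * (1 + a) := by nlinarith
    simp only [Set.mem_ofPred_eq, map_smul, _root_.smul_apply, smul_eq_mul, inv_div]
    rw [← mul_assoc, div_mul_div_comm, div_mul_eq_mul_div, div_lt_one (by positivity)]
    exact h3
  contMDiff := S.contMDiff_deform a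

/-- The `D`-homothetic deformation
`(φ, (1/a) ξ, a η, a g + a (a - 1) η ⊗ η)` of `(φ, ξ, η, g)`, for a constant `a > 0`. -/
def deform (a : ℝ) (ha : 0 < a) : AlmostContactMetricStructure I M where
  g := S.deformMetric a ha
  φ := S.φ
  ξ := fun x ↦ (1 / a) • S.ξ x
  η := fun x ↦ a • S.η x
  contMDiff_φ := S.contMDiff_φ
  contMDiff_ξ := S.contMDiff_ξ.const_smul_section (a := 1 / a)
  contMDiff_η := S.contMDiff_η.const_smul_section (a := a)
  φ_φ x v := by
    rw [S.φ_φ]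
    simp [smul_smul]
    field_simp
  η_ξ x := by
    simp [S.η_ξ, ha.ne']
  η_eq x v := by
    simp [deformMetric, S.η_ξ, ← S.η_eq]
    field_simp
    ring
  inner_φ_φ x v w := by
    have h := S.inner_φ_φ x v w
    simp only [deformMetric, _root_.add_apply, _root_.smul_apply,
      ContinuousLinearMap.smulRight_apply, smul_eq_mul, h, S.η_φ]
    ring

end AlmostContactMetricStructure
end

section

open Bundle FiberBundle NormedSpace Module VectorField
open scoped Topology

set_option linter.unusedSectionVars false

variable {E : Type*} [NormedAddCommGroup E] [NormedSpace ℝ E] [FiniteDimensional ℝ E]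
  {H : Type*} [TopologicalSpace H] {I : ModelWithCorners ℝ E H}
  {M : Type*} [TopologicalSpace M] [ChartedSpace H M] [IsManifold I ∞ M]

namespace Riem

/-! When `V` is the gradient of `f`, half of the Lie derivative of the metric is `Hess f`
(`half_lieDerivMetric_gradient`), so the soliton equation reads `Ric = λ g - Hess f`. In an
orthonormal frame, with `N` the dimension, `|λ g - Hess f|² = N λ² - 2 λ Δf + |Hess f|²`. As a
quadratic in the number `λ` this is least at `λ = Δf / N`, where it equals `|Hess f|² - (Δf)² / N`;
this is `sum_sq_sub_trace_sq_le`. The one analytic input is the symmetry of the Hessian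
(`hessian_symm`). It rests on zero torsion and on `[X, Y] f = X (Y f) - Y (X f)`, which is carried
to a chart and reduced there to the symmetry of second derivatives (`mvfderiv_mlieBracket`). -/

/-! ### The Lie bracket as a commutator of derivations. -/

theorem two_le_infty : (2 : ℕ∞ω) ≤ ∞ := WithTop.coe_le_coe.2 le_top

/-- In a chart, the derivative of `f` along `V` is the derivative of the coordinate expression of
`f` along the coordinate expression of `V`. -/
theorem fderivWithin_mpullbackWithin_extChartAt_symm {f : M → ℝ} {x : M} {z : E}
    (hz : z ∈ (extChartAt I x).target) (hf : MDiffAt f ((extChartAt I x).symm z))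
    (V : Π x : M, TangentSpace I x) :
    fderivWithin ℝ (f ∘ (extChartAt I x).symm) (Set.range I) z
        (mpullbackWithin 𝓘(ℝ, E) I (extChartAt I x).symm V (Set.range I) z) =
      d% f ((extChartAt I x).symm z) (V ((extChartAt I x).symm z)) := by
  have hr : z ∈ Set.range I := extChartAt_target_subset_range x hz
  have h1 := mfderiv_comp_mfderivWithin z hf
    ((contMDiffWithinAt_extChartAt_symm_range (n := ∞) x hz).mdifferentiableWithinAt (by simp))
    (I.uniqueMDiffOn z hr)
  -- Invertibility on the chart target makes the `inverse` inside `mpullbackWithin` a true inverse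
  -- rather than the default `0`; it then cancels the chain-rule factor.
  obtain ⟨A, hA⟩ := isInvertible_mfderivWithin_extChartAt_symm (I := I) hz
  rw [mfderivWithin_eq_fderivWithin] at h1
  rw [mpullbackWithin_apply, ← hA, ContinuousLinearMap.inverse_equiv]
  rw [← hA] at h1
  have h2 := congrArg (fun B : E →L[ℝ] ℝ ↦ B (A.symm (V ((extChartAt I x).symm z)))) h1
  refine h2.trans ?_
  change mfderiv% f ((extChartAt I x).symm z) (A (A.symm _)) = _
  rw [A.apply_symm_apply]
  rfl

/-- Moves the iterated derivative entirely into the chart, where the vector-space bracket formula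
applies. The two integrands agree only on the chart target, but that is a neighbourhood of the base
point within `range I`, which determines `fderivWithin`. -/
theorem mvfderiv_mvfderiv_apply {f : M → ℝ} (hf : ContMDiff I 𝓘(ℝ, ℝ) ∞ f)
    {V : Π x : M, TangentSpace I x} {x : M} (hV : MDiffAt (fun y ↦ d% f y (V y)) x)
    (v : TangentSpace I x) :
    d% (fun y ↦ d% f y (V y)) x v =
      fderivWithin ℝ (fun z ↦ fderivWithin ℝ (f ∘ (extChartAt I x).symm) (Set.range I) z
        (mpullbackWithin 𝓘(ℝ, E) I (extChartAt I x).symm V (Set.range I) z)) (Set.range I)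
        (extChartAt I x x) v := by
  rw [hV.mvfderiv]
  congr 1
  refine Filter.EventuallyEq.fderivWithin_eq_of_mem ?_ (Set.mem_range_self _)
  filter_upwards [extChartAt_target_mem_nhdsWithin (I := I) x] with z hz
  exact (fderivWithin_mpullbackWithin_extChartAt_symm hz
    (hf.mdifferentiableAt (by simp)) V).symm

/-- The derivative along `[X, Y]` is the commutator of the derivatives along `X` and `Y`. -/
theorem mvfderiv_mlieBracket {f : M → ℝ} (hf : ContMDiff I 𝓘(ℝ, ℝ) ∞ f)
    {X Y : Π x : M, TangentSpace I x} {x : M} (hX : MDiffAt (T% X) x) (hY : MDiffAt (T% Y) x)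
    (hfX : MDiffAt (fun y ↦ d% f y (X y)) x) (hfY : MDiffAt (fun y ↦ d% f y (Y y)) x) :
    d% f x (mlieBracket I X Y x) =
      d% (fun y ↦ d% f y (Y y)) x (X x) - d% (fun y ↦ d% f y (X y)) x (Y x) := by
  -- At its own base point the preferred chart has the identity as derivative, so pulling back does
  -- not change the vector.
  have hpull (V : Π x : M, TangentSpace I x) :
      (mpullbackWithin 𝓘(ℝ, E) I (extChartAt I x).symm V (Set.range I) (extChartAt I x x) : E) =
        V x := by
    rw [← mfderivWithin_extChartAt_symm_inverse_apply (V x), mpullbackWithin_apply]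
    congr 1
    exact congrArg (fun y ↦ (V y : E)) (extChartAt_to_inv x)
  have : IsManifold I 2 M := IsManifold.of_le (n := ∞) two_le_infty
  have hr : extChartAt I x x ∈ Set.range I := Set.mem_range_self _
  have hX' := hX.mdifferentiableWithinAt
    (s := Set.univ) |>.differentiableWithinAt_mpullbackWithin_vectorField
  have hY' := hY.mdifferentiableWithinAt
    (s := Set.univ) |>.differentiableWithinAt_mpullbackWithin_vectorField
  rw [Set.preimage_univ, Set.univ_inter] at hX' hY'
  have hF : ContDiffWithinAt ℝ ∞ (f ∘ (extChartAt I x).symm) (Set.range I) (extChartAt I x x) :=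
    (contMDiffAt_iff.1 (hf x)).2
  have key := fderivWithin_apply_lieBracket hF (by simpa using two_le_infty) I.uniqueDiffOn
    (I.range_subset_closure_interior hr) hr hY' hX'
  rw [mvfderiv_mvfderiv_apply hf hfX, mvfderiv_mvfderiv_apply hf hfY,
    (hf.mdifferentiableAt (by simp) : MDiffAt f x).mvfderiv, ← mlieBracketWithin_univ,
    mlieBracketWithin_apply, mfderiv_extChartAt_self,
    Set.preimage_univ, Set.univ_inter]
  rw [hpull, hpull] at key
  refine Eq.trans ?_ key
  congr 1
  exact congrArg (fun A : E →L[ℝ] E ↦ A _) (ContinuousLinearMap.inverse_id (R := ℝ) (M := E))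

/-! ### The Hessian and the Lie derivative of the metric. -/

variable {g : ContMDiffRiemannianMetric I ∞ E (fun x : M ↦ TangentSpace I x)}

theorem inner_gradient (f : M → ℝ) (x : M) (v : TangentSpace I x) :
    g.inner x (gradient g f x) v = d% f x v :=
  inner_flat_symm g x _ v

theorem leviCivita_sub_leviCivita {X Y : Π x : M, TangentSpace I x} {x : M}
    (hX : MDiffAt (T% X) x) (hY : MDiffAt (T% Y) x) :
    leviCivita g Y x (X x) - leviCivita g X x (Y x) = mlieBracket I X Y x :=
  (CovariantDerivative.torsion_eq_zero_iff _).1 (leviCivita_torsion g) hX hY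

/-- Metric compatibility gives `Hess f (X, Y) = X (Y f) - df (∇_X Y)`. By zero torsion the
antisymmetric part is `[X, Y] f - df [X, Y]`, with the first bracket a commutator of derivatives,
and this vanishes. -/
theorem hessian_symm {f : M → ℝ} (hf : ContMDiff I 𝓘(ℝ, ℝ) ∞ f) {x : M}
    (hG : MDiffAt (T% (gradient g f)) x) (v w : TangentSpace I x) :
    hessian g f x v w = hessian g f x w v := by
  have hv := mdifferentiableAt_extend I E v
  have hw := mdifferentiableAt_extend I E w
  have h1 := leviCivita_metric g hv hG hw
  have h2 := leviCivita_metric g hw hG hv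
  have hfv := mdifferentiableAt_inner (g := g) hG hv
  have hfw := mdifferentiableAt_inner (g := g) hG hw
  simp only [inner_gradient] at h1 h2 hfv hfw
  have h3 := mvfderiv_mlieBracket hf hv hw hfv hfw
  rw [← leviCivita_sub_leviCivita (g := g) hv hw, map_sub] at h3
  simp only [extend_apply_self] at h1 h2 h3
  simp only [hessian]
  linarith

/-- Expand `V g(X, Y)` by metric compatibility; zero torsion turns each `∇_V X - [V, X]` into `∇_X
V`. -/
theorem lieDerivMetric_eq {V : Π x : M, TangentSpace I x} {x : M} (hV : MDiffAt (T% V) x)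
    (v w : TangentSpace I x) :
    lieDerivMetric g V x v w =
      g.inner x (leviCivita g V x v) w + g.inner x (leviCivita g V x w) v := by
  have hv := mdifferentiableAt_extend I E v
  have hw := mdifferentiableAt_extend I E w
  have h1 := leviCivita_metric g hV hv hw
  rw [lieDerivMetric, h1, ← leviCivita_sub_leviCivita (g := g) hV hv,
    ← leviCivita_sub_leviCivita (g := g) hV hw]
  simp only [extend_apply_self, map_sub, _root_.sub_apply]
  rw [g.symm x v (leviCivita g V x w)]
  ring

theorem half_lieDerivMetric_gradient {f : M → ℝ} (hf : ContMDiff I 𝓘(ℝ, ℝ) ∞ f) {x : M}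
    (hG : MDiffAt (T% (gradient g f)) x) (v w : TangentSpace I x) :
    (1 / 2 : ℝ) * lieDerivMetric g (gradient g f) x v w = hessian g f x v w := by
  have h := hessian_symm hf hG v w
  rw [lieDerivMetric_eq hG]
  simp only [hessian] at h ⊢
  linarith

/-! ### Traces in an orthonormal frame and the pointwise inequality. -/

theorem inner_eq_orthonormalFrame_repr (x : M) (v : TangentSpace I x)
    (i : Fin (finrank ℝ (TangentSpace I x))) :
    g.inner x v (orthonormalFrame g x i) = (orthonormalFrame g x).repr v i := by
  conv_lhs => rw [← (orthonormalFrame g x).sum_repr v]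
  simp only [map_sum, map_smul, _root_.sum_apply, _root_.smul_apply, inner_orthonormalFrame,
    smul_eq_mul, mul_ite, mul_one, mul_zero, Finset.sum_ite_eq', Finset.mem_univ, if_true]

theorem laplacian_eq_sum_hessian (f : M → ℝ) (x : M) :
    laplacian g f x =
      ∑ i, hessian g f x (orthonormalFrame g x i) (orthonormalFrame g x i) := by
  rw [laplacian, divergence, LinearMap.trace_eq_matrix_trace ℝ (orthonormalFrame g x), Matrix.trace]
  refine Finset.sum_congr rfl fun i _ ↦ ?_
  rw [Matrix.diag_apply, LinearMap.toMatrix_apply, hessian, inner_eq_orthonormalFrame_repr]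
  rfl

/-- Subtracting a multiple of the identity from a square matrix decreases its squared
Hilbert-Schmidt norm by at most the squared norm of its trace part. -/
theorem sum_sq_sub_trace_sq_le {ι : Type*} [Fintype ι] [DecidableEq ι] [Nonempty ι]
    (A : ι → ι → ℝ) (c : ℝ) :
    ∑ i, ∑ j, A i j ^ 2 - 1 / (Fintype.card ι : ℝ) * (∑ i, A i i) ^ 2 ≤
      ∑ i, ∑ j, (c * (if i = j then 1 else 0) - A i j) ^ 2 := by
  have h : ∀ i j, (c * (if i = j then 1 else 0) - A i j) ^ 2 =
      (if i = j then c ^ 2 - 2 * c * A i j else 0) + A i j ^ 2 := by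
    intro i j
    split_ifs <;> ring
  simp only [h, Finset.sum_add_distrib, Finset.sum_ite_eq, Finset.mem_univ, if_true,
    Finset.sum_sub_distrib, ← Finset.mul_sum, Finset.sum_const, Finset.card_univ, nsmul_eq_mul]
  set N : ℝ := (Fintype.card ι : ℝ)
  set T := ∑ i, A i i
  have hN : 0 < N := by exact Nat.cast_pos.2 Fintype.card_pos
  -- This quotient is exactly the right side minus the left side, so equality holds only for `c = T
  -- / N`.
  have h2 : 0 ≤ (N * c - T) ^ 2 / N := by positivity
  have h3 : (N * c - T) ^ 2 / N = N * c ^ 2 - 2 * c * T + 1 / N * T ^ 2 := by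
    field_simp
    ring
  linarith

/-- The Ricci tensor of a gradient almost Ricci soliton is at least as long as the trace-free part
of the Hessian of its potential. -/
theorem IsAlmostRicciSoliton.hsNormSq_hessian_le {f lam : M → ℝ}
    (hf : ContMDiff I 𝓘(ℝ, ℝ) ∞ f) (h : IsAlmostRicciSoliton g (gradient g f) lam)
    (hE : 0 < finrank ℝ E) (x : M) :
    hsNormSq g x (hessian g f x) - 1 / (finrank ℝ E : ℝ) * laplacian g f x ^ 2 ≤
      hsNormSq g x (ricci g x) := by
  -- Differentiability of the gradient is read off from the smoothness of the soliton field.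
  have hG : MDiffAt (T% (gradient g f)) x := h.contMDiff_field.mdifferentiableAt (by simp)
  have hric (i j : Fin (finrank ℝ (TangentSpace I x))) :
      ricci g x (orthonormalFrame g x i) (orthonormalFrame g x j) =
        lam x * (if i = j then 1 else 0) -
          hessian g f x (orthonormalFrame g x i) (orthonormalFrame g x j) := by
    rw [← inner_orthonormalFrame g x i j, ← h.eqn, half_lieDerivMetric_gradient hf hG]
    ring
  have : Nonempty (Fin (finrank ℝ (TangentSpace I x))) := ⟨⟨0, hE⟩⟩
  have key := sum_sq_sub_trace_sq_le
    (fun i j ↦ hessian g f x (orthonormalFrame g x i) (orthonormalFrame g x j)) (lam x)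
  rw [Fintype.card_fin, ← laplacian_eq_sum_hessian] at key
  simp only [hsNormSq, hric]
  exact key

end Riem
end

theorem mainTheorem8 (n : ℕ) {M : Type*} [TopologicalSpace M] [T2Space M]
    [SecondCountableTopology M] [ChartedSpace (EuclideanSpace ℝ (Fin (2 * n + 1))) M]
    [IsManifold (𝓡 (2 * n + 1)) ∞ M]
    (S : AlmostContactMetricStructure (𝓡 (2 * n + 1)) M) (hS : S.IsKenmotsu)
    (a : ℝ) (ha : 0 < a) (f lam : M → ℝ) (hf : ContMDiff (𝓡 (2 * n + 1)) 𝓘(ℝ, ℝ) ∞ f)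
    (hsol : Riem.IsAlmostRicciSoliton (S.deform a ha).g (Riem.gradient (S.deform a ha).g f) lam)
    (x : M) :
    Riem.hsNormSq (S.deform a ha).g x (Riem.hessian (S.deform a ha).g f x)
        - 1 / (2 * (n : ℝ) + 1) * Riem.laplacian (S.deform a ha).g f x ^ 2
      ≤ Riem.hsNormSq (S.deform a ha).g x (Riem.ricci (S.deform a ha).g x) := by
  have h := hsol.hsNormSq_hessian_le hf (by simp) x
  simpa using h
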